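/- Let $\mathcal C$ be a class of groups, closed under isomorphism, under free products $A*B$ and under subgroups of finite index, and containing the infinite cyclic group $\mathbb Z$. Let $\sigma:\mathcal C\to\mathbb R$ be a mapping that takes equal values on isomorphic groups, such that $\sigma(\mathbb Z)=0$ and such that for every $G\in\mathcal C$ the net $\left(\frac{\sigma(H)}{[G:H]}\right)_{H}$, indexed by the subgroups $H$ of finite index of $G$ (directed by reverse inclusion), is bounded. For $G\in\mathcal C$ let $$V_\sigma(G)=\limsup_{H}\frac{\sigma(H)}{[G:H]}=\inf_{H}\ \sup_{K\le H}\frac{\sigma(K)}{[G:K]},$$ where $H$ and $K$ run over subgroups of finite index of $G$. Define the extended volume by $\widetilde V_\sigma(G)=-\frac1{|G|}$ if $G$ is finite (in $\mathcal C$ or not) and $\widetilde V_\sigma(G)=V_\sigma(G)$ if $G\in\mathcal C$ is infinite; and if $G$ is infinite and not in $\mathcal C$, but has a subgroup $K$ of finite index with $K\in\mathcal C$, put $\widetilde V_\sigma(G)=\frac{V_\sigma(K)}{[G:K]}$ (this does not depend on $K$). Let $A$ and $B$ range over the groups that are in $\mathcal C$ or finite. Then $A*B$ is finite or has a subgroup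 of finite index in $\mathcal C$, so that $\widetilde V_\sigma(A*B)$ is defined, and: (i) If $\sigma(A'*B')\ge\sigma(A')+\sigma(B')+1$ for all $A',B'\in\mathcal C$, then $\widetilde V_\sigma(A*B)\ge\widetilde V_\sigma(A)+\widetilde V_\sigma(B)+1$ for all such $A,B$. (ii) If $\sigma(A'*B')\le\sigma(A')+\sigma(B')+1$ for all $A',B'\in\mathcal C$, then $\widetilde V_\sigma(A*B)\le\widetilde V_\sigma(A)+\widetilde V_\sigma(B)+1$ for all such $A,B$. -/

import Mathlib

open scoped Monoid.Coprod

universe u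

/-- A class of groups, given by its membership predicate. -/
abbrev GroupClass := ∀ (G : Type u) [Group G], Prop

/-- A real number attached to every group; only the values on the class under consideration are
ever used. -/
abbrev GroupInvariant := ∀ (G : Type u) [Group G], ℝ

/-- `C` is closed under isomorphism. -/
def GroupClass.IsoClosed (C : GroupClass.{u}) : Prop :=
  ∀ (G H : Type u) [Group G] [Group H], C G → Nonempty (G ≃* H) → C H

/-- `C` is closed under subgroups of finite index. -/
def GroupClass.FiniteIndexClosed (C : GroupClass.{u}) : Prop :=
  ∀ (G : Type u) [Group G] (H : Subgroup G), C G → H.FiniteIndex → C H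

/-- `C` is closed under (binary) free products. -/
def GroupClass.FreeProductClosed (C : GroupClass.{u}) : Prop :=
  ∀ (A B : Type u) [Group A] [Group B], C A → C B → C (A ∗ B)

/-- `G` has a subgroup of finite index that belongs to `C`. -/
def GroupClass.Virtually (C : GroupClass.{u}) (G : Type u) [Group G] : Prop :=
  ∃ K : Subgroup G, K.FiniteIndex ∧ C K

/-- The union of the class `C` and the class of finite groups. -/
def GroupClass.OrFinite (C : GroupClass.{u}) (G : Type u) [Group G] : Prop :=
  C G ∨ Finite G

/-- The infinite cyclic group, written multiplicatively, in an arbitrary universe. -/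
abbrev InfCyclic : Type u := ULift.{u} (Multiplicative ℤ)

/-- On `C`, the mapping `σ` takes equal values on isomorphic groups. -/
def GroupInvariant.IsoInvariantOn (σ : GroupInvariant.{u}) (C : GroupClass.{u}) : Prop :=
  ∀ (G H : Type u) [Group G] [Group H], C G → C H → Nonempty (G ≃* H) → σ G = σ H

/-- For every `G` in `C`, the net `σ(H) / [G : H]`, indexed by the subgroups `H` of finite index
of `G`, is bounded. -/
def GroupInvariant.BoundedNetsOn (σ : GroupInvariant.{u}) (C : GroupClass.{u}) : Prop :=
  ∀ (G : Type u) [Group G], C G →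
    ∃ M : ℝ, ∀ H : Subgroup G, H.FiniteIndex → |σ H / (H.index : ℝ)| ≤ M

/-- The `σ`-volume: the upper limit of `σ(H) / [G : H]` over the subgroups `H` of finite index of
`G`, directed by reverse inclusion, that is `inf_H sup_{K ≤ H} σ(K) / [G : K]`. -/
noncomputable def sigmaVolume (σ : GroupInvariant.{u}) (G : Type u) [Group G] : EReal :=
  ⨅ (H : Subgroup G) (_ : H.FiniteIndex),
    ⨆ (K : Subgroup G) (_ : K.FiniteIndex) (_ : K ≤ H), ((σ K / (K.index : ℝ) : ℝ) : EReal)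

open Classical in
/-- The extended volume: `-1 / |G|` if `G` is finite, and the `σ`-volume of `G` if `G` is infinite
and in `C`. An infinite group `G` outside `C` that has a subgroup `K` of finite index in `C` gets
the value `V_σ(K) / [G : K]` (Wall's extension of the `σ`-volume to the groups that are virtually
in `C`). All other groups get the irrelevant value `0`. -/
noncomputable def extVolume (C : GroupClass.{u}) (σ : GroupInvariant.{u})
    (G : Type u) [Group G] : EReal :=
  if Finite G then ((-1 / (Nat.card G : ℝ) : ℝ) : EReal)
  else if C G then sigmaVolume σ G
  else if h : C.Virtually G then sigmaVolume σ h.choose / ((h.choose.index : ℝ) : EReal)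
  else 0

/-!
A subgroup `H` of finite index of `A ∗ B` is the stabilizer of a point `x₀` of `X = (A ∗ B) / H`. By
the Kurosh theorem it is the free product of the stabilizers in `A` and in `B` of one point of every
orbit, which are the intersections of conjugates of `H` with the factors, and of a free group. The
free generators and the orbits number `[A ∗ B : H] + 1` in total. If `σ + 1` is super- or
subadditive on free products, then bounds `≥ r` or `≤ r` on `σ / index` for these intersections add
up to such a bound for `H`, namely the sum of the two bounds plus `1`. Well-chosen `H` make the
intersections run through the subgroups that matter for the volumes of `A` and `B`. Giving `σ` the
value `-1` on the trivial groups makes the finite groups a special case.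

For the Kurosh theorem, choose the base points as the least points of their orbits in a well-order
of `X` that refines the word length of elements moving `x₀` to the given point. The graph that joins
every point to its two base points then has a spanning tree, whose edges go down to `x₀`. The
remaining edges index the free generators. A functor from the action groupoid of a free product is
given by its restrictions to the two factors. This defines a cocycle with values in the required
free product that is trivial on the tree, and the cocycle is an isomorphism on the stabilizer of
`x₀`.
-/

open Monoid MulAction

section Cocycles

variable {K X P Q : Type*} [Group K] [MulAction K X] [Group P] [Group Q]

/-- A cocycle of a group `K` acting on `X` with values in a group `P`: a functor from the action
groupoid of `X` to `P`, where `c k x` is the value on the arrow from `x` to `k • x`. -/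
@[ext]
structure ActionCocycle (K X P : Type*) [Group K] [MulAction K X] [Group P] where
  toFun : K → X → P
  map_mul' : ∀ k l x, toFun (k * l) x = toFun k (l • x) * toFun l x

namespace ActionCocycle

instance : CoeFun (ActionCocycle K X P) fun _ => K → X → P := ⟨toFun⟩

theorem map_mul (c : ActionCocycle K X P) (k l : K) (x : X) :
    c (k * l) x = c k (l • x) * c l x :=
  c.map_mul' k l x

theorem map_one (c : ActionCocycle K X P) (x : X) : c 1 x = 1 := by
  simpa using c.map_mul 1 1 x

theorem map_inv (c : ActionCocycle K X P) (k : K) (x : X) : c k⁻¹ (k • x) = (c k x)⁻¹ := by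
  rw [eq_inv_iff_mul_eq_one, ← c.map_mul, inv_mul_cancel, c.map_one]

/-- The homomorphism `f`, as a cocycle that does not depend on the point. -/
@[simps]
def ofHom (X : Type*) [MulAction K X] (f : K →* P) : ActionCocycle K X P where
  toFun k _ := f k
  map_mul' k l _ := _root_.map_mul f k l

/-- The composition of a cocycle with a homomorphism. -/
@[simps]
def map (f : P →* Q) (c : ActionCocycle K X P) : ActionCocycle K X Q where
  toFun k x := f (c k x)
  map_mul' k l x := by rw [c.map_mul, _root_.map_mul]

/-- The cocycle that is cohomologous to `c` by means of the function `u`. -/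
@[simps]
def twist (c : ActionCocycle K X P) (u : X → P) : ActionCocycle K X P where
  toFun k x := u (k • x) * c k x * (u x)⁻¹
  map_mul' k l x := by rw [c.map_mul, mul_smul]; group

/-- The restriction of a cocycle to the vertex group at `x`. -/
@[simps]
def stabilizerHom (c : ActionCocycle K X P) (x : X) : stabilizer K x →* P where
  toFun k := c k x
  map_one' := c.map_one x
  map_mul' k l := by rw [Subgroup.coe_mul, c.map_mul, l.2]

theorem apply_mem_range_stabilizerHom (c : ActionCocycle K X P) {x₀ : X} {p : X → K}
    (hp : ∀ x, p x • x₀ = x) (hc : ∀ x, c (p x) x₀ = 1) (k : K) (x : X) :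
    c k x ∈ (c.stabilizerHom x₀).range := by
  have hp_inv (y : X) : (p y)⁻¹ • y = x₀ := by rw [inv_smul_eq_iff, hp]
  have hc_inv (y : X) : c (p y)⁻¹ y = 1 := by
    have h := c.map_inv (p y) x₀
    rwa [hp, hc, inv_one] at h
  have hmem : (p (k • x))⁻¹ * k * p x ∈ stabilizer K x₀ := by
    rw [mem_stabilizer_iff, mul_smul, mul_smul, hp, hp_inv]
  refine ⟨⟨_, hmem⟩, (?_ : c ((p (k • x))⁻¹ * k * p x) x₀ = c k x)⟩
  rw [mul_assoc, c.map_mul, c.map_mul, mul_smul, hp, hc_inv, hc, one_mul, mul_one]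

/-- The action of `K` on the trivial bundle over `X` with fibre `P` that is given by `c`. -/
@[simps]
def toPerm (c : ActionCocycle K X P) : K →* Equiv.Perm (P × X) where
  toFun k :=
    { toFun := fun z => (c k z.2 * z.1, k • z.2)
      invFun := fun z => (c k⁻¹ z.2 * z.1, k⁻¹ • z.2)
      left_inv := fun z => by simp [← mul_assoc, ← c.map_mul, c.map_one]
      right_inv := fun z => by
        have h := c.map_mul k k⁻¹ z.2
        rw [mul_inv_cancel, c.map_one] at h
        simp [← mul_assoc, ← h] }
  map_one' := by ext z <;> simp [c.map_one]
  map_mul' k l := by ext z <;> simp [c.map_mul, mul_smul, mul_assoc]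

end ActionCocycle

/-- The action of the free product `A ∗ B` on `X` extends the given actions of `A` and `B`. -/
class IsCoprodAction (A B X : Type*) [Group A] [Group B] [MulAction A X] [MulAction B X]
    [MulAction (A ∗ B) X] : Prop where
  inl_smul : ∀ (a : A) (x : X), (Coprod.inl a : A ∗ B) • x = a • x
  inr_smul : ∀ (b : B) (x : X), (Coprod.inr b : A ∗ B) • x = b • x

namespace ActionCocycle

open Coprod IsCoprodAction

variable {A B : Type*} [Group A] [Group B] [MulAction (A ∗ B) X]

theorem coprod_ext {c d : ActionCocycle (A ∗ B) X P}
    (hl : ∀ (a : A) x, c (inl a) x = d (inl a) x) (hr : ∀ (b : B) x, c (inr b) x = d (inr b) x) :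
    c = d := by
  ext g x
  induction g using Coprod.induction_on generalizing x with
  | inl a => exact hl a x
  | inr b => exact hr b x
  | mul g h hg hh => rw [c.map_mul, d.map_mul, hg, hh]

variable [MulAction A X] [MulAction B X] [IsCoprodAction A B X]

theorem lift_toPerm_apply (c : ActionCocycle A X P) (d : ActionCocycle B X P) (g : A ∗ B) (p : P)
    (x : X) :
    lift c.toPerm d.toPerm g (p, x) = ((lift c.toPerm d.toPerm g (1, x)).1 * p, g • x) := by
  induction g using Coprod.induction_on generalizing p x with
  | inl a => simp [inl_smul]
  | inr b => simp [inr_smul]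
  | mul g h hg hh =>
    rw [_root_.map_mul, Equiv.Perm.mul_apply, Equiv.Perm.mul_apply, hh p x, hg, hh 1 x, hg (_ * 1)]
    simp only [mul_one, mul_assoc, mul_smul]

/-- The unique common extension of cocycles of `A` and of `B` to their free product. -/
def coprod (c : ActionCocycle A X P) (d : ActionCocycle B X P) : ActionCocycle (A ∗ B) X P where
  toFun g x := (lift c.toPerm d.toPerm g (1, x)).1
  map_mul' g h x := by
    rw [_root_.map_mul, Equiv.Perm.mul_apply, lift_toPerm_apply c d h,
      lift_toPerm_apply c d g, mul_one]

theorem coprod_inl (c : ActionCocycle A X P) (d : ActionCocycle B X P) (a : A) (x : X) :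
    coprod c d (inl a) x = c a x := by
  simp [coprod]

theorem coprod_inr (c : ActionCocycle A X P) (d : ActionCocycle B X P) (b : B) (x : X) :
    coprod c d (inr b) x = d b x := by
  simp [coprod]

end ActionCocycle

end Cocycles

section OrbitSections

/-- A choice of a base point `rep ω` in every orbit `ω` of `K` on `X` and, for every `x`, of an
element `tr x` that moves the base point of its orbit to `x`. -/
structure OrbitSection (K X : Type*) [Group K] [MulAction K X] where
  rep : orbitRel.Quotient K X → X
  mk_rep : ∀ ω, Quotient.mk'' (rep ω) = ω
  tr : X → K
  tr_smul : ∀ x, tr x • rep (Quotient.mk'' x) = x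
  tr_rep : ∀ ω, tr (rep ω) = 1

namespace OrbitSection

variable {K X P : Type*} [Group K] [MulAction K X] [Group P] (s : OrbitSection K X)

/-- The base point of the orbit of `x`. -/
def root (x : X) : X := s.rep (Quotient.mk'' x)

theorem rep_injective : Function.Injective s.rep :=
  Function.LeftInverse.injective s.mk_rep

theorem mk_smul (k : K) (x : X) :
    (Quotient.mk'' (k • x) : orbitRel.Quotient K X) = Quotient.mk'' x :=
  Quotient.sound' ⟨k, rfl⟩

theorem root_smul (k : K) (x : X) : s.root (k • x) = s.root x := by
  rw [root, mk_smul, root]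

theorem root_mem_range (x : X) : s.root x ∈ Set.range s.rep := ⟨_, rfl⟩

theorem root_eq_iff_mem_range {x : X} : s.root x = x ↔ x ∈ Set.range s.rep := by
  refine ⟨fun h => ⟨_, h⟩, ?_⟩
  rintro ⟨ω, rfl⟩
  rw [root, s.mk_rep]

theorem tr_eq_one {x : X} (h : s.root x = x) : s.tr x = 1 := by
  rw [← h]
  exact s.tr_rep _

theorem exists_root_le [LinearOrder X] [WellFoundedLT X] :
    ∃ s : OrbitSection K X, ∀ x, s.root x ≤ x := by
  classical
  have exists_least (ω : orbitRel.Quotient K X) :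
      ∃ y : X, Quotient.mk'' y = ω ∧ ∀ x, Quotient.mk'' x = ω → y ≤ x := by
    obtain ⟨y, hy, hmin⟩ := wellFounded_lt.has_min {x : X | Quotient.mk'' x = ω}
      (Quotient.inductionOn' ω fun x => ⟨x, rfl⟩)
    exact ⟨y, hy, fun x hx => not_lt.1 (hmin x hx)⟩
  choose r hr hmin using exists_least
  have exists_tr (x : X) : ∃ k : K, k • r (Quotient.mk'' x) = x :=
    orbitRel_apply.1 (Quotient.exact (hr (Quotient.mk'' x)).symm)
  choose t ht using exists_tr
  refine ⟨⟨r, hr, fun x => if x = r (Quotient.mk'' x) then 1 else t x, fun x => ?_, fun ω => ?_⟩,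
    fun x => hmin _ x rfl⟩
  · split_ifs with h
    · rw [one_smul, ← h]
    · exact ht x
  · rw [hr, if_pos rfl]

theorem tr_conj_mem (k : K) (x : X) :
    (s.tr (k • x))⁻¹ * k * s.tr x ∈ stabilizer K (s.rep (Quotient.mk'' x)) := by
  rw [mem_stabilizer_iff, mul_smul, s.tr_smul, mul_smul, inv_smul_eq_iff]
  conv_rhs => rw [← mk_smul k x, s.tr_smul]

variable (θ : ∀ ω, stabilizer K (s.rep ω) →* P)

theorem apply_congr {ω ω' : orbitRel.Quotient K X} (h : ω = ω') {k k' : K} (hk : k = k')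
    (hm : k ∈ stabilizer K (s.rep ω)) (hm' : k' ∈ stabilizer K (s.rep ω')) :
    θ ω ⟨k, hm⟩ = θ ω' ⟨k', hm'⟩ := by
  subst h hk
  rfl

/-- The cocycle that is given by homomorphisms on the stabilizers of the base points and is
trivial on the chosen arrows from the base points. -/
def cocycle : ActionCocycle K X P where
  toFun k x := θ (Quotient.mk'' x) ⟨_, s.tr_conj_mem k x⟩
  map_mul' k l x := by
    have hmem := s.tr_conj_mem k (l • x)
    rw [mk_smul] at hmem
    rw [s.apply_congr θ (mk_smul l x) rfl (s.tr_conj_mem k (l • x)) hmem, ← map_mul]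
    refine s.apply_congr θ rfl ?_ _ _
    rw [mul_smul]
    simp only [mul_assoc, mul_inv_cancel_left]

theorem cocycle_rep (ω : orbitRel.Quotient K X) (k : stabilizer K (s.rep ω)) :
    s.cocycle θ k (s.rep ω) = θ ω k :=
  s.apply_congr θ (s.mk_rep ω) (by rw [mem_stabilizer_iff.1 k.2, s.tr_rep]; group) _ k.2

theorem cocycle_tr (x : X) : s.cocycle θ (s.tr x) (s.root x) = 1 := by
  rw [← map_one (θ (Quotient.mk'' x))]
  exact s.apply_congr θ (s.mk_rep _) (by rw [root, s.tr_smul, s.tr_rep]; group) _ (one_mem _)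

end OrbitSection

end OrbitSections

section Descent

variable {A B X : Type*} [Group A] [Group B] [MulAction A X] [MulAction B X]

section

variable [MulAction (A ∗ B) X] [IsCoprodAction A B X] [IsPretransitive (A ∗ B) X]

open Coprod IsCoprodAction

variable (A B)

theorem exists_length_smul_lt (x₀ : X) : ∃ ℓ : X → ℕ,
    ∀ x ≠ x₀, (∃ a : A, ℓ (a • x) < ℓ x) ∨ ∃ b : B, ℓ (b • x) < ℓ x := by
  classical
  have exists_word (x : X) : ∃ n, ∃ w : List (A ⊕ B), w.length = n ∧
      (Coprod.mk (FreeMonoid.ofList w) : A ∗ B) • x₀ = x := by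
    obtain ⟨g, rfl⟩ := exists_smul_eq (A ∗ B) x₀ x
    obtain ⟨w, rfl⟩ := mk_surjective g
    exact ⟨_, FreeMonoid.toList w, rfl, rfl⟩
  refine ⟨fun x => Nat.find (exists_word x), fun x hx => ?_⟩
  obtain ⟨w, hw, hwx⟩ := Nat.find_spec (exists_word x)
  cases w with
  | nil => exact absurd (by simpa using hwx.symm) hx
  | cons c w =>
    have shorter {y : X} (hy : (Coprod.mk (FreeMonoid.ofList w) : A ∗ B) • x₀ = y) :
        Nat.find (exists_word y) < Nat.find (exists_word x) :=
      (Nat.find_min' _ ⟨w, rfl, hy⟩).trans_lt (hw ▸ Nat.lt_succ_self _)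
    have hcx : (Coprod.mk (FreeMonoid.of c) : A ∗ B) •
        (Coprod.mk (FreeMonoid.ofList w) : A ∗ B) • x₀ = x := by
      rw [smul_smul, ← map_mul]
      exact hwx
    cases c with
    | inl a => exact .inl ⟨a⁻¹, shorter (by rw [← hcx, mk_of_inl, inl_smul, inv_smul_smul])⟩
    | inr b => exact .inr ⟨b⁻¹, shorter (by rw [← hcx, mk_of_inr, inr_smul, inv_smul_smul])⟩

theorem exists_wellOrder_smul_lt (x₀ : X) : ∃ _ : LinearOrder X, WellFoundedLT X ∧
    ∀ x ≠ x₀, (∃ a : A, a • x < x) ∨ ∃ b : B, b • x < x := by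
  obtain ⟨ℓ, hℓ⟩ := exists_length_smul_lt A B x₀
  obtain ⟨_, _⟩ := exists_wellFoundedLT X
  let f : X → ℕ ×ₗ X := fun x => toLex (ℓ x, x)
  have hf : f.Injective := fun x y h => congrArg (fun z => (ofLex z).2) h
  refine ⟨.lift' f hf, ⟨InvImage.wf f wellFounded_lt⟩, fun x hx => ?_⟩
  exact (hℓ x hx).imp (fun ⟨a, h⟩ => ⟨a, Prod.Lex.toLex_lt_toLex.2 (.inl h)⟩)
    fun ⟨b, h⟩ => ⟨b, Prod.Lex.toLex_lt_toLex.2 (.inl h)⟩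

end

variable [LinearOrder X]

/-- The base points chosen by `sA` and `sB` are least in their orbits, and `x₀` is the only point
that is a base point for both. In the graph on `X` with an edge from `x` to its base point for
each of the factors, this says that every point other than `x₀` has an edge going down. -/
structure IsDescending (sA : OrbitSection A X) (sB : OrbitSection B X) (x₀ : X) : Prop where
  root_left_le : ∀ x, sA.root x ≤ x
  root_right_le : ∀ x, sB.root x ≤ x
  root_lt : ∀ x ≠ x₀, sA.root x < x ∨ sB.root x < x

theorem exists_isDescending [WellFoundedLT X] {x₀ : X}
    (h : ∀ x ≠ x₀, (∃ a : A, a • x < x) ∨ ∃ b : B, b • x < x) :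
    ∃ (sA : OrbitSection A X) (sB : OrbitSection B X), IsDescending sA sB x₀ := by
  obtain ⟨sA, hA⟩ := OrbitSection.exists_root_le (K := A) (X := X)
  obtain ⟨sB, hB⟩ := OrbitSection.exists_root_le (K := B) (X := X)
  refine ⟨sA, sB, hA, hB, fun x hx => (h x hx).imp ?_ ?_⟩
  · rintro ⟨a, ha⟩
    exact (sA.root_smul a x ▸ hA (a • x)).trans_lt ha
  · rintro ⟨b, hb⟩
    exact (sB.root_smul b x ▸ hB (b • x)).trans_lt hb

/-- The points that are not base points of their orbits under either factor. They stand for the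
edges outside the spanning tree: of the two edges that go down from such a point, the tree contains
only the one for `A`. -/
def extraEdges {X : Type*} [MulAction A X] [MulAction B X] (sA : OrbitSection A X)
    (sB : OrbitSection B X) : Set X :=
  (Set.range sA.rep ∪ Set.range sB.rep)ᶜ

namespace IsDescending

open Coprod

variable [WellFoundedLT X] {sA : OrbitSection A X} {sB : OrbitSection B X} {x₀ : X}

theorem le (h : IsDescending sA sB x₀) (x : X) : x₀ ≤ x := by
  induction x using WellFoundedLT.induction with
  | _ x ih =>
    by_cases hx : x = x₀
    · exact hx.ge
    · exact (h.root_lt x hx).elim (fun hlt => (ih _ hlt).trans hlt.le)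
        fun hlt => (ih _ hlt).trans hlt.le

theorem root_left (h : IsDescending sA sB x₀) : sA.root x₀ = x₀ :=
  (h.root_left_le x₀).antisymm (h.le _)

theorem root_right (h : IsDescending sA sB x₀) : sB.root x₀ = x₀ :=
  (h.root_right_le x₀).antisymm (h.le _)

theorem range_inter_range (h : IsDescending sA sB x₀) :
    Set.range sA.rep ∩ Set.range sB.rep = {x₀} := by
  ext x
  rw [Set.mem_inter_iff, ← sA.root_eq_iff_mem_range, ← sB.root_eq_iff_mem_range,
    Set.mem_singleton_iff]
  refine ⟨fun ⟨hA, hB⟩ => ?_, ?_⟩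
  · by_contra hx
    exact (h.root_lt x hx).elim (fun hlt => hlt.ne hA) fun hlt => hlt.ne hB
  · rintro rfl
    exact ⟨h.root_left, h.root_right⟩

theorem card_add_card_extraEdges [Finite X] (h : IsDescending sA sB x₀) :
    Nat.card (orbitRel.Quotient A X) + Nat.card (orbitRel.Quotient B X) +
      Nat.card (extraEdges sA sB) = Nat.card X + 1 := by
  have card_left : (Set.range sA.rep).ncard = Nat.card (orbitRel.Quotient A X) :=
    Nat.card_range_of_injective sA.rep_injective
  have card_right : (Set.range sB.rep).ncard = Nat.card (orbitRel.Quotient B X) :=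
    Nat.card_range_of_injective sB.rep_injective
  have card_union := Set.ncard_union_add_ncard_inter (Set.range sA.rep) (Set.range sB.rep)
  rw [h.range_inter_range, Set.ncard_singleton] at card_union
  have card_compl := Set.ncard_add_ncard_compl (Set.range sA.rep ∪ Set.range sB.rep)
  rw [Nat.card_coe_set_eq, extraEdges]
  omega

theorem induction (h : IsDescending sA sB x₀) {Q : X → Prop} (base : Q x₀)
    (left : ∀ x, Q (sA.root x) → Q x) (right : ∀ x ∉ extraEdges sA sB, Q (sB.root x) → Q x)
    (x : X) : Q x := by
  induction x using WellFoundedLT.induction with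
  | _ x ih =>
    rcases (h.root_left_le x).lt_or_eq with hlt | heq
    · exact left x (ih _ hlt)
    by_cases hx : x = x₀
    · exact hx ▸ base
    · exact right x (fun hc => hc (.inl (sA.root_eq_iff_mem_range.1 heq)))
        (ih _ ((h.root_lt x hx).resolve_left heq.not_lt))

end IsDescending

/-- The element of `A ∗ B` that moves `x₀` to `x` along the edges that go down from `x`, where
the edge of the factor `A` is preferred. -/
noncomputable def descentPath [WellFoundedLT X] (sA : OrbitSection A X) (sB : OrbitSection B X)
    (x : X) : A ∗ B :=
  if _ : sA.root x < x then Coprod.inl (sA.tr x) * descentPath sA sB (sA.root x)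
  else if _ : sB.root x < x then Coprod.inr (sB.tr x) * descentPath sA sB (sB.root x)
  else 1
termination_by (wellFounded_lt (α := X)).wrap x
decreasing_by all_goals assumption

namespace IsDescending

open Coprod

variable [WellFoundedLT X] {sA : OrbitSection A X} {sB : OrbitSection B X} {x₀ : X}

theorem descentPath_base (h : IsDescending sA sB x₀) : descentPath sA sB x₀ = 1 := by
  rw [descentPath, dif_neg h.root_left.not_lt, dif_neg h.root_right.not_lt]

theorem descentPath_left (h : IsDescending sA sB x₀) (x : X) :
    descentPath sA sB x = inl (sA.tr x) * descentPath sA sB (sA.root x) := by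
  rcases (h.root_left_le x).lt_or_eq with hlt | heq
  · rw [descentPath, dif_pos hlt]
  · rw [sA.tr_eq_one heq, heq, map_one, one_mul]

theorem descentPath_right (h : IsDescending sA sB x₀) {x : X} (hx : x ∉ extraEdges sA sB) :
    descentPath sA sB x = inr (sB.tr x) * descentPath sA sB (sB.root x) := by
  rcases (h.root_right_le x).lt_or_eq with hlt | heq
  · have hA : x ∈ Set.range sA.rep := (not_not.1 hx).resolve_right fun hB =>
      hlt.ne (sB.root_eq_iff_mem_range.2 hB)
    rw [descentPath, dif_neg (sA.root_eq_iff_mem_range.2 hA).not_lt, dif_pos hlt]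
  · rw [sB.tr_eq_one heq, heq, map_one, one_mul]

end IsDescending

end Descent

section Kurosh

open Coprod IsCoprodAction

variable {A B X : Type*} [Group A] [Group B] [MulAction A X] [MulAction B X]
  (sA : OrbitSection A X) (sB : OrbitSection B X)

/-- The free product of the stabilizers of all base points and of the free group on the extra
edges: the decomposition of the stabilizer of a point in the Kurosh subgroup theorem. -/
abbrev KuroshProduct : Type _ :=
  (CoprodI (fun ω => stabilizer A (sA.rep ω)) ∗ CoprodI (fun ω => stabilizer B (sB.rep ω))) ∗
    FreeGroup (extraEdges sA sB)

/-- The factor of the Kurosh product at a base point of the first group. -/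
def kuroshLeft (ω : orbitRel.Quotient A X) : stabilizer A (sA.rep ω) →* KuroshProduct sA sB :=
  inl.comp (inl.comp (CoprodI.of (M := fun ω => stabilizer A (sA.rep ω))))

/-- The factor of the Kurosh product at a base point of the second group. -/
def kuroshRight (ω : orbitRel.Quotient B X) : stabilizer B (sB.rep ω) →* KuroshProduct sA sB :=
  inl.comp (inr.comp (CoprodI.of (M := fun ω => stabilizer B (sB.rep ω))))

open Classical in
/-- The value of the Kurosh cocycle on the arrow of the second group from the base point to `x`:
a free generator if `x` is an extra edge, and otherwise trivial. -/
noncomputable def edgeValue (x : X) : KuroshProduct sA sB :=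
  if h : x ∈ extraEdges sA sB then inr (FreeGroup.of ⟨x, h⟩) else 1

theorem edgeValue_root (x : X) : edgeValue sA sB (sB.root x) = 1 :=
  dif_neg fun h => h (.inr (sB.root_mem_range x))

theorem coprodI_range_le {ι N : Type*} {G : ι → Type*} [∀ i, Group (G i)] [Group N]
    {f : CoprodI G →* N} {H : Subgroup N} (h : ∀ i (x : G i), f (.of x) ∈ H) : f.range ≤ H := by
  rw [← CoprodI.lift_comp_of' f, CoprodI.range_eq_iSup, iSup_le_iff]
  rintro i _ ⟨x, rfl⟩
  exact h i x

variable {sA sB} in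
theorem KuroshProduct.eq_top {H : Subgroup (KuroshProduct sA sB)}
    (left : ∀ ω a, kuroshLeft sA sB ω a ∈ H) (right : ∀ ω b, kuroshRight sA sB ω b ∈ H)
    (free : ∀ x : extraEdges sA sB, edgeValue sA sB x ∈ H) : H = ⊤ := by
  rw [eq_top_iff, ← range_inl_sup_range_inr]
  refine sup_le ((range_eq (K := KuroshProduct sA sB) inl).trans_le (sup_le ?_ ?_)) ?_
  · exact coprodI_range_le left
  · exact coprodI_range_le right
  · rw [MonoidHom.range_eq_map, ← FreeGroup.closure_range_of, Subgroup.map_le_iff_le_comap,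
      Subgroup.closure_le]
    rintro _ ⟨x, rfl⟩
    have hx := free x
    rwa [edgeValue, dif_pos x.2] at hx

/-- The Kurosh cocycle. On the first group it is trivial along the arrows chosen by `sA`; on the
second group it sends the arrows chosen by `sB` to the values `edgeValue`. -/
noncomputable def kuroshCocycle [MulAction (A ∗ B) X] [IsCoprodAction A B X] :
    ActionCocycle (A ∗ B) X (KuroshProduct sA sB) :=
  .coprod (sA.cocycle (kuroshLeft sA sB))
    ((sB.cocycle (kuroshRight sA sB)).twist (edgeValue sA sB))

section

variable [MulAction (A ∗ B) X] [IsCoprodAction A B X]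

theorem kuroshCocycle_inl_tr (x : X) :
    kuroshCocycle sA sB (inl (sA.tr x)) (sA.root x) = 1 := by
  rw [kuroshCocycle, ActionCocycle.coprod_inl, sA.cocycle_tr]

theorem kuroshCocycle_inr_tr (x : X) :
    kuroshCocycle sA sB (inr (sB.tr x)) (sB.root x) = edgeValue sA sB x := by
  rw [kuroshCocycle, ActionCocycle.coprod_inr, ActionCocycle.twist_toFun, sB.cocycle_tr,
    edgeValue_root, OrbitSection.root, sB.tr_smul]
  group

theorem kuroshCocycle_inl_rep (ω) (a : stabilizer A (sA.rep ω)) :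
    kuroshCocycle sA sB (inl (a : A)) (sA.rep ω) = kuroshLeft sA sB ω a := by
  rw [kuroshCocycle, ActionCocycle.coprod_inl, sA.cocycle_rep]

theorem kuroshCocycle_inr_rep (ω) (b : stabilizer B (sB.rep ω)) :
    kuroshCocycle sA sB (inr (b : B)) (sB.rep ω) = kuroshRight sA sB ω b := by
  have hω : edgeValue sA sB (sB.rep ω) = 1 := dif_neg fun h => h (.inr ⟨ω, rfl⟩)
  rw [kuroshCocycle, ActionCocycle.coprod_inr, ActionCocycle.twist_toFun, sB.cocycle_rep,
    mem_stabilizer_iff.1 b.2, hω]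
  group

end

variable {sA sB}

/-- The homomorphism from the Kurosh product to `A ∗ B` that is given by a family of paths
`p x` from a common starting point to the points `x`. -/
noncomputable def kuroshHom (p : X → A ∗ B) : KuroshProduct sA sB →* A ∗ B :=
  lift (lift
    (CoprodI.lift fun ω => (MulAut.conj (p (sA.rep ω))⁻¹).toMonoidHom.comp
      (inl.comp (Subgroup.subtype _)))
    (CoprodI.lift fun ω => (MulAut.conj (p (sB.rep ω))⁻¹).toMonoidHom.comp
      (inr.comp (Subgroup.subtype _))))
    (FreeGroup.lift fun x => (p x)⁻¹ * inr (sB.tr x) * p (sB.root x))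

theorem kuroshHom_left (p : X → A ∗ B) (ω) (a : stabilizer A (sA.rep ω)) :
    kuroshHom p (kuroshLeft sA sB ω a) = (p (sA.rep ω))⁻¹ * inl (a : A) * p (sA.rep ω) := by
  simp [kuroshHom, kuroshLeft]

theorem kuroshHom_right (p : X → A ∗ B) (ω) (b : stabilizer B (sB.rep ω)) :
    kuroshHom p (kuroshRight sA sB ω b) = (p (sB.rep ω))⁻¹ * inr (b : B) * p (sB.rep ω) := by
  simp [kuroshHom, kuroshRight]

variable [LinearOrder X] [WellFoundedLT X] {x₀ : X}

namespace IsDescending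

theorem kuroshHom_edgeValue (h : IsDescending sA sB x₀) (x : X) :
    kuroshHom (descentPath sA sB) (edgeValue sA sB x) =
      (descentPath sA sB x)⁻¹ * inr (sB.tr x) * descentPath sA sB (sB.root x) := by
  by_cases hx : x ∈ extraEdges sA sB
  · simp [edgeValue, hx, kuroshHom]
  · rw [edgeValue, dif_neg hx, map_one, h.descentPath_right hx]
    group

variable [MulAction (A ∗ B) X] [IsCoprodAction A B X]

theorem map_kuroshCocycle (h : IsDescending sA sB x₀) :
    (kuroshCocycle sA sB).map (kuroshHom (descentPath sA sB)) =
      (ActionCocycle.ofHom X (MonoidHom.id (A ∗ B))).twist fun x => (descentPath sA sB x)⁻¹ := by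
  refine ActionCocycle.coprod_ext (fun a x => ?_) fun b x => ?_
  · simp only [kuroshCocycle, ActionCocycle.map_toFun, ActionCocycle.twist_toFun,
      ActionCocycle.ofHom_toFun, ActionCocycle.coprod_inl, OrbitSection.cocycle, kuroshHom_left,
      inl_smul]
    rw [h.descentPath_left (a • x), h.descentPath_left x, sA.root_smul, OrbitSection.root]
    simp only [map_mul, map_inv, MonoidHom.id_apply]
    group
  · simp only [kuroshCocycle, ActionCocycle.map_toFun, ActionCocycle.twist_toFun,
      ActionCocycle.ofHom_toFun, ActionCocycle.coprod_inr, OrbitSection.cocycle, map_mul, map_inv,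
      kuroshHom_right, h.kuroshHom_edgeValue, inr_smul, sB.root_smul, MonoidHom.id_apply]
    rw [OrbitSection.root]
    group

theorem descentPath_smul (h : IsDescending sA sB x₀) (x : X) :
    descentPath sA sB x • x₀ = x := by
  induction x using h.induction with
  | base => rw [h.descentPath_base, one_smul]
  | left x hx => rw [h.descentPath_left, mul_smul, hx, inl_smul, OrbitSection.root, sA.tr_smul]
  | right x hxE hx =>
    rw [h.descentPath_right hxE, mul_smul, hx, inr_smul, OrbitSection.root, sB.tr_smul]

theorem kuroshCocycle_descentPath (h : IsDescending sA sB x₀) (x : X) :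
    kuroshCocycle sA sB (descentPath sA sB x) x₀ = 1 := by
  induction x using h.induction with
  | base => rw [h.descentPath_base, ActionCocycle.map_one]
  | left x hx =>
    rw [h.descentPath_left, ActionCocycle.map_mul, hx, h.descentPath_smul, kuroshCocycle_inl_tr,
      mul_one]
  | right x hxE hx =>
    rw [h.descentPath_right hxE, ActionCocycle.map_mul, hx, h.descentPath_smul,
      kuroshCocycle_inr_tr, edgeValue, dif_neg hxE, mul_one]

theorem stabilizerHom_injective (h : IsDescending sA sB x₀) :
    Function.Injective ((kuroshCocycle sA sB).stabilizerHom x₀) := by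
  have left_inverse (g : stabilizer (A ∗ B) x₀) :
      kuroshHom (descentPath sA sB) ((kuroshCocycle sA sB).stabilizerHom x₀ g) = g := by
    have hg := congrArg (fun c : ActionCocycle (A ∗ B) X (A ∗ B) => c g x₀) h.map_kuroshCocycle
    simpa [mem_stabilizer_iff.1 g.2, h.descentPath_base] using hg
  exact fun g k hgk => Subtype.ext (by rw [← left_inverse g, hgk, left_inverse])

theorem stabilizerHom_surjective (h : IsDescending sA sB x₀) :
    Function.Surjective ((kuroshCocycle sA sB).stabilizerHom x₀) := by
  have mem_range := (kuroshCocycle sA sB).apply_mem_range_stabilizerHom h.descentPath_smul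
    h.kuroshCocycle_descentPath
  refine MonoidHom.range_eq_top.1 (KuroshProduct.eq_top (fun ω a => ?_) (fun ω b => ?_) fun x => ?_)
  · exact kuroshCocycle_inl_rep sA sB ω a ▸ mem_range _ _
  · exact kuroshCocycle_inr_rep sA sB ω b ▸ mem_range _ _
  · exact kuroshCocycle_inr_tr sA sB (x : X) ▸ mem_range _ _

end IsDescending

end Kurosh

section

variable {A B X : Type*} [Group A] [Group B] [MulAction A X] [MulAction B X]
  [MulAction (A ∗ B) X] [IsCoprodAction A B X] [IsPretransitive (A ∗ B) X]

variable (A B) in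
theorem exists_stabilizer_mulEquiv_kuroshProduct [Finite X] (x₀ : X) :
    ∃ (sA : OrbitSection A X) (sB : OrbitSection B X),
      Nat.card (orbitRel.Quotient A X) + Nat.card (orbitRel.Quotient B X) +
        Nat.card (extraEdges sA sB) = Nat.card X + 1 ∧
      Nonempty (stabilizer (A ∗ B) x₀ ≃* KuroshProduct sA sB) := by
  obtain ⟨_, _, hlt⟩ := exists_wellOrder_smul_lt A B x₀
  obtain ⟨sA, sB, h⟩ := exists_isDescending hlt
  exact ⟨sA, sB, h.card_add_card_extraEdges,
    ⟨.ofBijective _ ⟨h.stabilizerHom_injective, h.stabilizerHom_surjective⟩⟩⟩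

end

section FreeProducts

variable {ι : Type*} (W : ι → Type*) [∀ i, Group (W i)]

theorem nonempty_coprodI_mulEquiv_coprod (i : ι) :
    Nonempty (CoprodI W ≃* W i ∗ CoprodI fun j : {j // j ≠ i} => W j) := by
  classical
  let split : ∀ j, W j →* W i ∗ CoprodI fun j : {j // j ≠ i} => W j := fun j =>
    if h : j = i then h ▸ Coprod.inl
    else Coprod.inr.comp (CoprodI.of (M := fun j : {j // j ≠ i} => W j) (i := ⟨j, h⟩))
  have split_self : split i = Coprod.inl := dif_pos rfl
  have split_ne (j : {j // j ≠ i}) : split j =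
      Coprod.inr.comp (CoprodI.of (M := fun j : {j // j ≠ i} => W j)) := dif_neg j.2
  refine ⟨MonoidHom.toMulEquiv (CoprodI.lift split)
    (Coprod.lift CoprodI.of (CoprodI.lift fun _ => CoprodI.of)) ?_ ?_⟩
  · ext j w
    obtain rfl | h := eq_or_ne j i
    · simp [split_self]
    · simp [split_ne ⟨j, h⟩]
  · refine Coprod.hom_ext ?_ (CoprodI.ext_hom _ _ fun j => ?_) <;> ext w
    · simp [split_self]
    · simp [split_ne j]

instance [IsEmpty ι] : Subsingleton (CoprodI W) :=
  subsingleton_of_forall_eq 1 fun x => by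
    induction x using CoprodI.induction_on with
    | one => rfl
    | of i _ => exact (IsEmpty.false i).elim
    | mul x y hx hy => rw [hx, hy, one_mul]

theorem nonempty_coprodI_infCyclic_mulEquiv_freeGroup (κ : Type*) :
    Nonempty (CoprodI (fun _ : κ => InfCyclic.{u}) ≃* FreeGroup κ) :=
  have basis : FreeGroupBasis Unit InfCyclic.{u} :=
    ⟨MulEquiv.ulift.trans FreeGroup.mulEquivIntOfUnique.symm⟩
  ⟨((CoprodI.FreeGroupBasis.coprodI fun _ => basis).reindex
    (Equiv.sigmaUnique κ fun _ => Unit)).repr⟩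

end FreeProducts

open Pointwise in
theorem stabilizer_compHom_mk {K G : Type*} [Group K] [Group G] (φ : K →* G) (H : Subgroup G)
    (g : G) :
    let _ : MulAction K (G ⧸ H) := .compHom _ φ
    stabilizer K (g : G ⧸ H) = (MulAut.conj g • H).comap φ := by
  have stabilizer_eq : stabilizer G (g : G ⧸ H) = H.map (MulAut.conj g).toMonoidHom := by
    simpa using stabilizer_smul_eq_stabilizer_map_conj g ((1 : G) : G ⧸ H)
  exact congrArg (Subgroup.comap φ) stabilizer_eq

/-- A relation between groups and elements of a commutative monoid that is compatible with free
products, such as `f G ≤ r` for a subadditive isomorphism invariant `f`. -/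
structure IsCoprodAdditive {M : Type*} [AddCommMonoid M]
    (P : ∀ (G : Type u) [Group G], M → Prop) : Prop where
  of_mulEquiv {G H : Type u} [Group G] [Group H] {r : M} : G ≃* H → P G r → P H r
  of_subsingleton (G : Type u) [Group G] [Subsingleton G] : P G 0
  coprod {A B : Type u} [Group A] [Group B] {r s : M} : P A r → P B s → P (A ∗ B) (r + s)

namespace IsCoprodAdditive

variable {M : Type*} [AddCommMonoid M] {P : ∀ (G : Type u) [Group G], M → Prop}

theorem coprodI (h : IsCoprodAdditive P) {ι : Type u} [Fintype ι] {W : ι → Type u}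
    [∀ i, Group (W i)] {r : ι → M} (hW : ∀ i, P (W i) (r i)) : P (CoprodI W) (∑ i, r i) := by
  classical
  induction hn : Fintype.card ι generalizing ι with
  | zero =>
    have := Fintype.card_eq_zero_iff.1 hn
    rw [Fintype.sum_empty]
    exact h.of_subsingleton _
  | succ n ih =>
    obtain ⟨i⟩ := Fintype.card_pos_iff.1 (hn ▸ n.succ_pos : 0 < Fintype.card ι)
    obtain ⟨e⟩ := nonempty_coprodI_mulEquiv_coprod W i
    rw [Fintype.sum_eq_add_sum_subtype_ne r i]
    exact h.of_mulEquiv e.symm (h.coprod (hW i) (ih (fun j => hW j) (by simp [hn])))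

theorem freeGroup (h : IsCoprodAdditive P) {e : M} (he : P InfCyclic e) (ι : Type u) [Finite ι] :
    P (FreeGroup ι) (Nat.card ι • e) := by
  have := Fintype.ofFinite ι
  obtain ⟨φ⟩ := nonempty_coprodI_infCyclic_mulEquiv_freeGroup ι
  simpa using h.of_mulEquiv φ (h.coprodI fun _ : ι => he)

theorem coprodI_stabilizer (h : IsCoprodAdditive P) {K X : Type u} [Group K] [MulAction K X]
    [Finite X] (s : OrbitSection K X) {a e : M}
    (hP : ∀ x : X, P (stabilizer K x) ((stabilizer K x).index • a + e)) :
    P (CoprodI fun ω => stabilizer K (s.rep ω))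
      (Nat.card X • a + Nat.card (orbitRel.Quotient K X) • e) := by
  have := Fintype.ofFinite (orbitRel.Quotient K X)
  have finite_quotient (ω) : Finite (K ⧸ stabilizer K (s.rep ω)) :=
    .of_equiv _ (orbitEquivQuotientStabilizer K (s.rep ω))
  have card_eq : Nat.card X = ∑ ω, (stabilizer K (s.rep ω)).index := by
    rw [Nat.card_congr (selfEquivSigmaOrbitsQuotientStabilizer' K X s.mk_rep), Nat.card_sigma]
    rfl
  simpa [card_eq, Finset.sum_add_distrib, Finset.sum_smul] using
    h.coprodI fun ω => hP (s.rep ω)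

open Coprod Pointwise in
theorem subgroup_coprod (h : IsCoprodAdditive P) {A B : Type u} [Group A] [Group B]
    (H : Subgroup (A ∗ B)) [H.FiniteIndex] {a b e : M} (he : P InfCyclic e)
    (hA : ∀ g : A ∗ B,
      P ((MulAut.conj g • H).comap inl) (((MulAut.conj g • H).comap inl).index • a + e))
    (hB : ∀ g : A ∗ B,
      P ((MulAut.conj g • H).comap inr) (((MulAut.conj g • H).comap inr).index • b + e)) :
    P H (H.index • (a + b + e) + e) := by
  let _ : MulAction A ((A ∗ B) ⧸ H) := .compHom _ (inl : A →* A ∗ B)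
  let _ : MulAction B ((A ∗ B) ⧸ H) := .compHom _ (inr : B →* A ∗ B)
  have : IsCoprodAction A B ((A ∗ B) ⧸ H) := ⟨fun _ _ => rfl, fun _ _ => rfl⟩
  obtain ⟨sA, sB, hcard, ⟨φ⟩⟩ :=
    exists_stabilizer_mulEquiv_kuroshProduct A B ((1 : A ∗ B) : (A ∗ B) ⧸ H)
  have left := h.coprodI_stabilizer sA (a := a) (e := e) fun x => by
    obtain ⟨g, rfl⟩ := QuotientGroup.mk_surjective x
    exact stabilizer_compHom_mk inl H g ▸ hA g
  have right := h.coprodI_stabilizer sB (a := b) (e := e) fun x => by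
    obtain ⟨g, rfl⟩ := QuotientGroup.mk_surjective x
    exact stabilizer_compHom_mk inr H g ▸ hB g
  have hP := h.of_mulEquiv φ.symm
    (h.coprod (h.coprod left right) (h.freeGroup he (extraEdges sA sB)))
  rw [stabilizer_quotient] at hP
  convert hP using 1
  -- The orbits of the two factors and the extra edges number `H.index + 1` in total.
  calc H.index • (a + b + e) + e = H.index • a + H.index • b + (H.index + 1) • e := by
        simp only [nsmul_add, succ_nsmul]; abel
    _ = _ := by
        rw [Subgroup.index, ← hcard, add_nsmul, add_nsmul]; abel

end IsCoprodAdditive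

section Volume

variable {D : GroupClass.{u}} {τ : GroupInvariant.{u}} {G : Type u} [Group G]

theorem div_index_le_iff (H : Subgroup G) [hH : H.FiniteIndex] {s r : ℝ} :
    s / H.index ≤ r ↔ s ≤ H.index • r := by
  rw [div_le_iff₀' (by exact_mod_cast hH.index_ne_zero.bot_lt), nsmul_eq_mul]

theorem le_div_index_iff (H : Subgroup G) [hH : H.FiniteIndex] {s r : ℝ} :
    r ≤ s / H.index ↔ H.index • r ≤ s := by
  rw [le_div_iff₀' (by exact_mod_cast hH.index_ne_zero.bot_lt), nsmul_eq_mul]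

theorem sigmaVolume_le {r : ℝ} (H : Subgroup G) [hH : H.FiniteIndex]
    (h : ∀ K ≤ H, K.FiniteIndex → τ K ≤ K.index • r) : sigmaVolume τ G ≤ r :=
  iInf₂_le_of_le H hH <| iSup_le fun K => iSup₂_le fun hK hKH =>
    EReal.coe_le_coe ((div_index_le_iff K).2 (h K hKH hK))

theorem exists_of_sigmaVolume_lt {r : ℝ} (h : sigmaVolume τ G < r) :
    ∃ H : Subgroup G, H.FiniteIndex ∧ ∀ K ≤ H, K.FiniteIndex → τ K ≤ K.index • r := by
  simp only [sigmaVolume, iInf_lt_iff] at h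
  obtain ⟨H, hH, h⟩ := h
  have h := h.le
  simp only [iSup_le_iff, EReal.coe_le_coe_iff] at h
  exact ⟨H, hH, fun K hKH hK => (div_index_le_iff K).1 (h K hK hKH)⟩

theorem le_sigmaVolume {r : ℝ} (h : ∀ H : Subgroup G, H.FiniteIndex →
    ∃ K ≤ H, K.FiniteIndex ∧ K.index • r ≤ τ K) : r ≤ sigmaVolume τ G := by
  refine le_iInf₂ fun H hH => ?_
  obtain ⟨K, hKH, hK, hr⟩ := h H hH
  exact le_iSup_of_le K (le_iSup₂_of_le hK hKH (EReal.coe_le_coe ((le_div_index_iff K).2 hr)))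

theorem exists_of_lt_sigmaVolume {r : ℝ} (h : r < sigmaVolume τ G) (H : Subgroup G)
    [hH : H.FiniteIndex] : ∃ K ≤ H, K.FiniteIndex ∧ K.index • r ≤ τ K := by
  have h := h.trans_le (iInf₂_le H hH)
  simp only [lt_iSup_iff] at h
  obtain ⟨K, hK, hKH, h⟩ := h
  exact ⟨K, hKH, hK, (le_div_index_iff K).1 (EReal.coe_lt_coe_iff.1 h).le⟩

theorem GroupClass.mem_map_subtype (hDi : D.IsoClosed) (hDf : D.FiniteIndexClosed)
    {K : Subgroup G} (hK : D K) (L : Subgroup K) [hL : L.FiniteIndex] : D (L.map K.subtype) :=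
  hDi L _ (hDf K L hK hL) ⟨L.equivMapOfInjective _ K.subtype_injective⟩

theorem GroupClass.mem_of_le (hDi : D.IsoClosed) (hDf : D.FiniteIndexClosed)
    {K L : Subgroup G} (hK : D K) [L.FiniteIndex] (hLK : L ≤ K) : D L :=
  Subgroup.map_subgroupOf_eq_of_le hLK ▸ GroupClass.mem_map_subtype hDi hDf hK (L.subgroupOf K)

theorem GroupInvariant.IsoInvariantOn.apply_map_subtype (hτ : τ.IsoInvariantOn D)
    (hDi : D.IsoClosed) (hDf : D.FiniteIndexClosed) {K : Subgroup G} (hK : D K) (L : Subgroup K)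
    [hL : L.FiniteIndex] : τ (L.map K.subtype) = τ L :=
  (hτ L _ (hDf K L hK hL) (GroupClass.mem_map_subtype hDi hDf hK L)
    ⟨L.equivMapOfInjective _ K.subtype_injective⟩).symm

theorem finiteIndex_map_subtype (K : Subgroup G) [hK : K.FiniteIndex] (L : Subgroup K)
    [hL : L.FiniteIndex] : (L.map K.subtype).FiniteIndex :=
  ⟨by simp [Subgroup.index_map_subtype, hL.index_ne_zero, hK.index_ne_zero]⟩

theorem sigmaVolume_eq_div (hDi : D.IsoClosed) (hDf : D.FiniteIndexClosed)
    (hτ : τ.IsoInvariantOn D) (K : Subgroup G) [hKf : K.FiniteIndex] (hK : D K) :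
    sigmaVolume τ G = sigmaVolume τ K / ((K.index : ℝ) : EReal) := by
  have index_pos : (0 : EReal) < ((K.index : ℝ) : EReal) := by
    exact_mod_cast hKf.index_ne_zero.bot_lt
  have index_nsmul (L : Subgroup K) (z : ℝ) :
      (L.map K.subtype).index • z = L.index • K.index • z := by
    rw [Subgroup.index_map_subtype, mul_nsmul']
  refine le_antisymm (EReal.le_of_forall_lt_iff_le.1 fun z hz => ?_)
    (EReal.le_of_forall_lt_iff_le.1 fun z hz => ?_)
  · rw [EReal.div_lt_iff index_pos (EReal.coe_ne_top _), mul_comm, ← EReal.coe_mul,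
      ← nsmul_eq_mul] at hz
    obtain ⟨H, hH, h⟩ := exists_of_sigmaVolume_lt hz
    have := finiteIndex_map_subtype K H
    refine sigmaVolume_le (H.map K.subtype) fun M hMH hM => ?_
    obtain ⟨L, hL, rfl⟩ : ∃ L : Subgroup K, L.FiniteIndex ∧ L.map K.subtype = M :=
      ⟨M.subgroupOf K, inferInstance,
        Subgroup.map_subgroupOf_eq_of_le (hMH.trans (Subgroup.map_subtype_le H))⟩
    rw [hτ.apply_map_subtype hDi hDf hK, index_nsmul]
    exact h L ((Subgroup.map_le_map_iff_of_injective K.subtype_injective).1 hMH) hL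
  · obtain ⟨H, hH, h⟩ := exists_of_sigmaVolume_lt hz
    rw [EReal.div_le_iff_le_mul index_pos (EReal.coe_ne_top _), ← EReal.coe_mul, ← nsmul_eq_mul]
    refine sigmaVolume_le (H.subgroupOf K) fun L hLH hL => ?_
    rw [← index_nsmul, ← hτ.apply_map_subtype hDi hDf hK]
    exact h _ (Subgroup.map_le_iff_le_comap.2 hLH) (finiteIndex_map_subtype K L)

end Volume

section Conjugation

open Pointwise

variable {G K : Type*} [Group G] [Group K]

instance finiteIndex_comap (φ : K →* G) (H : Subgroup G) [H.FiniteIndex] :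
    (H.comap φ).FiniteIndex :=
  ⟨by rw [H.index_comap]; exact Subgroup.FiniteIndex.index_ne_zero⟩

theorem index_conj_smul (g : G) (H : Subgroup G) : (MulAut.conj g • H).index = H.index :=
  H.index_map_equiv (MulAut.conj g)

instance finiteIndex_conj_smul (g : G) (H : Subgroup G) [hH : H.FiniteIndex] :
    (MulAut.conj g • H).FiniteIndex :=
  ⟨by rw [index_conj_smul]; exact hH.index_ne_zero⟩

theorem conj_smul_comap (χ : G →* K) (g : G) (P : Subgroup K) :
    MulAut.conj g • P.comap χ = (MulAut.conj (χ g) • P).comap χ := by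
  ext k
  simp [Subgroup.mem_pointwise_smul_iff_inv_smul_mem]

theorem comap_conj_smul_le {φ : K →* G} {χ : G →* K} (hχφ : χ.comp φ = .id K) {H : Subgroup G}
    {N : Subgroup K} [N.Normal] (hH : H ≤ N.comap χ) (g : G) :
    (MulAut.conj g • H).comap φ ≤ N :=
  calc (MulAut.conj g • H).comap φ ≤ (MulAut.conj g • N.comap χ).comap φ :=
        Subgroup.comap_mono (Subgroup.pointwise_smul_le_pointwise_smul_iff.2 hH)
    _ = N := by
        rw [conj_smul_comap, Subgroup.Normal.conj_smul_eq_self, Subgroup.comap_comap, hχφ,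
          Subgroup.comap_id]

theorem comap_conj_smul_inf {K' : Type*} [Group K'] {φ : K →* G} {χ : G →* K} {χ' : G →* K'}
    (hχφ : χ.comp φ = .id K) (hχ'φ : χ'.comp φ = 1) {N : Subgroup G} [N.Normal] {P : Subgroup K}
    (hP : P ≤ N.comap φ) (P' : Subgroup K') (g : G) :
    (MulAut.conj g • (N ⊓ P.comap χ ⊓ P'.comap χ')).comap φ = MulAut.conj (χ g) • P := by
  have hP : MulAut.conj (χ g) • P ≤ N.comap φ := by
    rw [← Subgroup.Normal.conj_smul_eq_self (χ g) (N.comap φ)]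
    exact Subgroup.pointwise_smul_le_pointwise_smul_iff.2 hP
  have comap_one (Q : Subgroup K') : Q.comap (1 : K →* K') = ⊤ :=
    top_le_iff.1 fun _ _ => one_mem Q
  simp [Subgroup.smul_inf, conj_smul_comap, Subgroup.comap_inf, Subgroup.comap_comap, hχφ, hχ'φ,
    comap_one, hP]

end Conjugation

section FreeProductVolume

open Coprod Pointwise

variable {D : GroupClass.{u}} {τ : GroupInvariant.{u}} {A B : Type u} [Group A] [Group B]

theorem GroupClass.Virtually.exists_normal (hDi : D.IsoClosed) (hDf : D.FiniteIndexClosed)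
    (hA : D.Virtually A) (A₁ : Subgroup A) [A₁.FiniteIndex] :
    ∃ N ≤ A₁, N.Normal ∧ N.FiniteIndex ∧ ∀ S ≤ N, S.FiniteIndex → D S := by
  obtain ⟨K, hKf, hK⟩ := hA
  have core_le : (A₁ ⊓ K).normalCore ≤ A₁ ⊓ K := Subgroup.normalCore_le _
  exact ⟨_, core_le.trans inf_le_left, inferInstance, inferInstance, fun S hS _ =>
    GroupClass.mem_of_le hDi hDf hK (hS.trans (core_le.trans inf_le_right))⟩

theorem GroupClass.Virtually.coprod (hDi : D.IsoClosed) (hDf : D.FiniteIndexClosed)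
    (hD : IsCoprodAdditive fun G _ (_ : Unit) => D G) (hDZ : D InfCyclic) (hA : D.Virtually A)
    (hB : D.Virtually B) : D.Virtually (A ∗ B) := by
  obtain ⟨NA, -, _, _, hNA⟩ := hA.exists_normal hDi hDf ⊤
  obtain ⟨NB, -, _, _, hNB⟩ := hB.exists_normal hDi hDf ⊤
  refine ⟨NA.comap fst ⊓ NB.comap snd, inferInstance,
    hD.subgroup_coprod _ (a := ()) (b := ()) (e := ()) hDZ (fun g => ?_) fun g => ?_⟩
  · exact hNA _ (comap_conj_smul_le fst_comp_inl inf_le_left g) inferInstance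
  · exact hNB _ (comap_conj_smul_le snd_comp_inr inf_le_right g) inferInstance

theorem sigmaVolume_coprod_le_of_lt (hDi : D.IsoClosed) (hDf : D.FiniteIndexClosed)
    (h : IsCoprodAdditive fun G _ r => D G ∧ τ G + 1 ≤ r) (hDZ : D InfCyclic)
    (hτZ : τ InfCyclic ≤ 0) (hA : D.Virtually A) (hB : D.Virtually B) {a b : ℝ}
    (ha : sigmaVolume τ A < a) (hb : sigmaVolume τ B < b) :
    sigmaVolume τ (A ∗ B) ≤ ((a + b + 1 : ℝ) : EReal) := by
  obtain ⟨A₁, _, hA₁⟩ := exists_of_sigmaVolume_lt ha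
  obtain ⟨B₁, _, hB₁⟩ := exists_of_sigmaVolume_lt hb
  obtain ⟨NA, hNA₁, _, _, hNA⟩ := hA.exists_normal hDi hDf A₁
  obtain ⟨NB, hNB₁, _, _, hNB⟩ := hB.exists_normal hDi hDf B₁
  refine sigmaVolume_le (NA.comap fst ⊓ NB.comap snd) fun H hH _ => ?_
  refine le_of_add_le_add_right (h.subgroup_coprod H (a := a) (b := b) (e := 1)
    ⟨hDZ, by linarith⟩ (fun g => ?_) fun g => ?_).2
  · have hS := comap_conj_smul_le fst_comp_inl (hH.trans inf_le_left) g
    exact ⟨hNA _ hS inferInstance, by gcongr; exact hA₁ _ (hS.trans hNA₁) inferInstance⟩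
  · have hS := comap_conj_smul_le snd_comp_inr (hH.trans inf_le_right) g
    exact ⟨hNB _ hS inferInstance, by gcongr; exact hB₁ _ (hS.trans hNB₁) inferInstance⟩

theorem le_conj_smul (hDi : D.IsoClosed) (hτ : τ.IsoInvariantOn D) {G : Type u} [Group G] (g : G)
    {S : Subgroup G} (hS : D S) {r : ℝ} (hr : S.index • r ≤ τ S) :
    D (MulAut.conj g • S : Subgroup G) ∧
      (MulAut.conj g • S).index • r ≤ τ (MulAut.conj g • S : Subgroup G) := by
  have e : Nonempty (S ≃* (MulAut.conj g • S : Subgroup G)) := ⟨S.equivSMul _⟩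
  have hgS := hDi _ _ hS e
  exact ⟨hgS, by rwa [index_conj_smul, ← hτ _ _ hS hgS e]⟩

theorem le_sigmaVolume_coprod_of_lt (hDi : D.IsoClosed) (hDf : D.FiniteIndexClosed)
    (hτ : τ.IsoInvariantOn D) (h : IsCoprodAdditive fun G _ r => D G ∧ τ G + 1 ≥ r)
    (hDZ : D InfCyclic) (hτZ : 0 ≤ τ InfCyclic) (hA : D.Virtually A) (hB : D.Virtually B)
    {a b : ℝ} (ha : a < sigmaVolume τ A) (hb : b < sigmaVolume τ B) :
    ((a + b + 1 : ℝ) : EReal) ≤ sigmaVolume τ (A ∗ B) := by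
  refine le_sigmaVolume fun H₀ _ => ?_
  let N := H₀.normalCore
  obtain ⟨NA, hNA_le, _, _, hNA⟩ := hA.exists_normal hDi hDf (N.comap inl)
  obtain ⟨NB, hNB_le, _, _, hNB⟩ := hB.exists_normal hDi hDf (N.comap inr)
  obtain ⟨A', hA', _, hA'a⟩ := exists_of_lt_sigmaVolume ha NA
  obtain ⟨B', hB', _, hB'b⟩ := exists_of_lt_sigmaVolume hb NB
  let H := N ⊓ A'.comap fst ⊓ B'.comap snd
  have comap_inl (g : A ∗ B) : (MulAut.conj g • H).comap inl = MulAut.conj (fst g) • A' :=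
    comap_conj_smul_inf fst_comp_inl snd_comp_inl (hA'.trans hNA_le) B' g
  have comap_inr (g : A ∗ B) : (MulAut.conj g • H).comap inr = MulAut.conj (snd g) • B' := by
    rw [← comap_conj_smul_inf snd_comp_inr fst_comp_inr (hB'.trans hNB_le) A' g, inf_right_comm]
  refine ⟨H, inf_le_left.trans (inf_le_left.trans H₀.normalCore_le), inferInstance,
    le_of_add_le_add_right (h.subgroup_coprod H (a := a) (b := b) (e := 1) ⟨hDZ, by linarith⟩
      (fun g => ?_) fun g => ?_).2⟩
  · obtain ⟨hD, hr⟩ := le_conj_smul hDi hτ (fst g) (hNA A' hA' inferInstance) hA'a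
    rw [comap_inl]
    exact ⟨hD, by gcongr⟩
  · obtain ⟨hD, hr⟩ := le_conj_smul hDi hτ (snd g) (hNB B' hB' inferInstance) hB'b
    rw [comap_inr]
    exact ⟨hD, by gcongr⟩

theorem sigmaVolume_coprod_le (hDi : D.IsoClosed) (hDf : D.FiniteIndexClosed)
    (h : IsCoprodAdditive fun G _ r => D G ∧ τ G + 1 ≤ r) (hDZ : D InfCyclic)
    (hτZ : τ InfCyclic ≤ 0) (hA : D.Virtually A) (hB : D.Virtually B)
    (h₁ : sigmaVolume τ A ≠ ⊥ ∨ sigmaVolume τ B ≠ ⊤)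
    (h₂ : sigmaVolume τ A ≠ ⊤ ∨ sigmaVolume τ B ≠ ⊥) :
    sigmaVolume τ (A ∗ B) ≤ sigmaVolume τ A + sigmaVolume τ B + 1 := by
  have one_ne : (1 : EReal) ≠ ⊥ ∧ (1 : EReal) ≠ ⊤ := ⟨EReal.coe_ne_bot 1, EReal.coe_ne_top 1⟩
  rw [← EReal.sub_le_iff_le_add (.inl one_ne.1) (.inl one_ne.2)]
  refine EReal.le_add_of_forall_gt h₁ h₂ fun a' ha' b' hb' => ?_
  obtain ⟨a, ha, haa'⟩ := EReal.lt_iff_exists_real_btwn.1 ha'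
  obtain ⟨b, hb, hbb'⟩ := EReal.lt_iff_exists_real_btwn.1 hb'
  rw [EReal.sub_le_iff_le_add (.inl one_ne.1) (.inl one_ne.2)]
  calc sigmaVolume τ (A ∗ B) ≤ ((a + b + 1 : ℝ) : EReal) :=
        sigmaVolume_coprod_le_of_lt hDi hDf h hDZ hτZ hA hB ha hb
    _ ≤ a' + b' + 1 := by push_cast; gcongr

theorem le_sigmaVolume_coprod (hDi : D.IsoClosed) (hDf : D.FiniteIndexClosed)
    (hτ : τ.IsoInvariantOn D) (h : IsCoprodAdditive fun G _ r => D G ∧ τ G + 1 ≥ r)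
    (hDZ : D InfCyclic) (hτZ : 0 ≤ τ InfCyclic) (hA : D.Virtually A) (hB : D.Virtually B) :
    sigmaVolume τ A + sigmaVolume τ B + 1 ≤ sigmaVolume τ (A ∗ B) := by
  have one_ne : (1 : EReal) ≠ ⊥ ∧ (1 : EReal) ≠ ⊤ := ⟨EReal.coe_ne_bot 1, EReal.coe_ne_top 1⟩
  rw [← EReal.le_sub_iff_add_le (.inl one_ne.1) (.inl one_ne.2)]
  refine EReal.add_le_of_forall_lt fun a' ha' b' hb' => ?_
  obtain ⟨a, haa', ha⟩ := EReal.lt_iff_exists_real_btwn.1 ha'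
  obtain ⟨b, hbb', hb⟩ := EReal.lt_iff_exists_real_btwn.1 hb'
  rw [EReal.le_sub_iff_add_le (.inl one_ne.1) (.inl one_ne.2)]
  calc a' + b' + 1 ≤ ((a + b + 1 : ℝ) : EReal) := by push_cast; gcongr
    _ ≤ sigmaVolume τ (A ∗ B) := le_sigmaVolume_coprod_of_lt hDi hDf hτ h hDZ hτZ hA hB ha hb

end FreeProductVolume

section Normalization

/-- The class `C`, enlarged by the trivial groups, so that all finite groups become virtually
members of the class. -/
def GroupClass.withTrivial (C : GroupClass.{u}) : GroupClass.{u} :=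
  fun G _ => C G ∨ Subsingleton G

open Classical in
/-- The invariant `σ`, with the value `-1` on the trivial groups. This value makes `σ + 1` additive
on free products with a trivial factor, and it makes `-1 / |G|` the volume of a finite group. -/
noncomputable def GroupInvariant.normalized (σ : GroupInvariant.{u}) : GroupInvariant.{u} :=
  fun G _ => if Subsingleton G then -1 else σ G

variable {C : GroupClass.{u}} {σ : GroupInvariant.{u}} {G A B : Type u} [Group G] [Group A]
  [Group B]

theorem GroupInvariant.normalized_of_subsingleton [Subsingleton G] : σ.normalized G = -1 :=
  if_pos ‹_›

theorem GroupInvariant.normalized_of_nontrivial [Nontrivial G] : σ.normalized G = σ G :=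
  if_neg (not_subsingleton G)

theorem GroupClass.IsoClosed.withTrivial (hC : C.IsoClosed) : C.withTrivial.IsoClosed := by
  rintro G H _ _ (hG | hG) ⟨e⟩
  · exact .inl (hC G H hG ⟨e⟩)
  · exact .inr e.symm.injective.subsingleton

theorem GroupClass.FiniteIndexClosed.withTrivial (hC : C.FiniteIndexClosed) :
    C.withTrivial.FiniteIndexClosed := by
  rintro G _ H (hG | hG) hH
  · exact .inl (hC G H hG hH)
  · exact .inr inferInstance

theorem GroupInvariant.IsoInvariantOn.normalized (hσ : σ.IsoInvariantOn C) :
    σ.normalized.IsoInvariantOn C.withTrivial := by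
  rintro G H _ _ hG hH ⟨e⟩
  obtain _ | _ := subsingleton_or_nontrivial G
  · have := e.symm.injective.subsingleton
    rw [normalized_of_subsingleton, normalized_of_subsingleton]
  · have := e.injective.nontrivial
    rw [normalized_of_nontrivial, normalized_of_nontrivial]
    exact hσ G H (hG.resolve_right (not_subsingleton G)) (hH.resolve_right (not_subsingleton H)) ⟨e⟩

theorem nonempty_mulEquiv_coprod_left {M N : Type*} [Group M] [Group N] [Subsingleton M] :
    Nonempty (N ≃* M ∗ N) :=
  let _ : Unique M := uniqueOfSubsingleton 1
  ⟨(MulEquiv.punitCoprod.{_, 0} N).symm.trans (MulEquiv.coprodCongr .ofUnique (.refl N))⟩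

theorem nonempty_mulEquiv_coprod_right {M N : Type*} [Group M] [Group N] [Subsingleton N] :
    Nonempty (M ≃* M ∗ N) :=
  let _ : Unique N := uniqueOfSubsingleton 1
  ⟨(MulEquiv.coprodPUnit.{_, 0} M).symm.trans (MulEquiv.coprodCongr (.refl M) .ofUnique)⟩

theorem isCoprodAdditive_withTrivial (hCi : C.IsoClosed) (hCf : C.FreeProductClosed) :
    IsCoprodAdditive fun G _ (_ : Unit) => C.withTrivial G where
  of_mulEquiv e hG := hCi.withTrivial _ _ hG ⟨e⟩
  of_subsingleton _ _ h := .inr h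
  coprod {A B} _ _ _ _ hA hB := by
    obtain _ | _ := subsingleton_or_nontrivial A
    · exact hCi.withTrivial B _ hB nonempty_mulEquiv_coprod_left
    obtain _ | _ := subsingleton_or_nontrivial B
    · exact hCi.withTrivial A _ hA nonempty_mulEquiv_coprod_right
    · exact .inl (hCf A B (hA.resolve_right (not_subsingleton A))
        (hB.resolve_right (not_subsingleton B)))

theorem normalized_coprod_add_one {R : ℝ → ℝ → Prop} [Std.Refl R] (hCi : C.IsoClosed)
    (hCf : C.FreeProductClosed) (hσ : σ.IsoInvariantOn C)
    (h : ∀ (A B : Type u) [Group A] [Group B], C A → C B →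
      R (σ (A ∗ B) + 1) (σ A + 1 + (σ B + 1)))
    (hA : C.withTrivial A) (hB : C.withTrivial B) :
    R (σ.normalized (A ∗ B) + 1) (σ.normalized A + 1 + (σ.normalized B + 1)) := by
  have hAB := (isCoprodAdditive_withTrivial hCi hCf).coprod (r := ()) (s := ()) hA hB
  obtain _ | _ := subsingleton_or_nontrivial A
  · rw [← hσ.normalized B _ hB hAB nonempty_mulEquiv_coprod_left,
      GroupInvariant.normalized_of_subsingleton (G := A), neg_add_cancel, zero_add]
    exact refl _
  obtain _ | _ := subsingleton_or_nontrivial B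
  · rw [← hσ.normalized A _ hA hAB nonempty_mulEquiv_coprod_right,
      GroupInvariant.normalized_of_subsingleton (G := B), neg_add_cancel, add_zero]
    exact refl _
  · have := (Coprod.inl_injective (M := A) (N := B)).nontrivial
    simp only [GroupInvariant.normalized_of_nontrivial]
    exact h A B (hA.resolve_right (not_subsingleton A)) (hB.resolve_right (not_subsingleton B))

theorem isCoprodAdditive_normalized {R : ℝ → ℝ → Prop} [Std.Refl R] [IsTrans ℝ R]
    (hR : ∀ {a b c d}, R a b → R c d → R (a + c) (b + d)) (hCi : C.IsoClosed)
    (hCf : C.FreeProductClosed) (hσ : σ.IsoInvariantOn C)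
    (h : ∀ (A B : Type u) [Group A] [Group B], C A → C B →
      R (σ (A ∗ B) + 1) (σ A + 1 + (σ B + 1))) :
    IsCoprodAdditive fun G _ r => C.withTrivial G ∧ R (σ.normalized G + 1) r where
  of_mulEquiv e hG :=
    have hH := hCi.withTrivial _ _ hG.1 ⟨e⟩
    ⟨hH, hσ.normalized _ _ hG.1 hH ⟨e⟩ ▸ hG.2⟩
  of_subsingleton G _ hG := by
    refine ⟨.inr hG, ?_⟩
    rw [GroupInvariant.normalized_of_subsingleton, neg_add_cancel]
    exact refl _
  coprod hA hB :=
    ⟨(isCoprodAdditive_withTrivial hCi hCf).coprod (r := ()) (s := ()) hA.1 hB.1,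
      trans_of R (normalized_coprod_add_one hCi hCf hσ h hA.1 hB.1) (hR hA.2 hB.2)⟩

theorem finite_of_finiteIndex (K : Subgroup G) [K.FiniteIndex] [Finite K] : Finite G :=
  .of_subgroup_quotient K

theorem GroupClass.virtually_withTrivial_iff :
    C.withTrivial.Virtually G ↔ Finite G ∨ C.Virtually G := by
  constructor
  · rintro ⟨K, hKf, hK | hK⟩
    · exact .inr ⟨K, hKf, hK⟩
    · exact .inl (finite_of_finiteIndex K)
  · rintro (hG | ⟨K, hKf, hK⟩)
    · exact ⟨⊥, inferInstance, .inr inferInstance⟩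
    · exact ⟨K, hKf, .inl hK⟩

theorem sigmaVolume_normalized_of_finite [Finite G] :
    sigmaVolume σ.normalized G = ((-1 / (Nat.card G : ℝ) : ℝ) : EReal) := by
  have bot_value : σ.normalized (⊥ : Subgroup G) = (⊥ : Subgroup G).index • (-1 / Nat.card G) := by
    rw [GroupInvariant.normalized_of_subsingleton, Subgroup.index_bot, nsmul_eq_mul,
      mul_div_cancel₀ _ (by exact_mod_cast Nat.card_pos.ne')]
  refine le_antisymm (sigmaVolume_le ⊥ fun K hK _ => ?_)
    (le_sigmaVolume fun H _ => ⟨⊥, bot_le, inferInstance, bot_value.ge⟩)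
  obtain rfl := le_bot_iff.1 hK
  exact bot_value.le

theorem sigmaVolume_normalized_of_infinite [Infinite G] :
    sigmaVolume σ.normalized G = sigmaVolume σ G := by
  have normalized_eq (K : Subgroup G) (_ : K.FiniteIndex) : σ.normalized K = σ K := by
    have : Nontrivial K := not_subsingleton_iff_nontrivial.1 fun _ =>
      not_finite_iff_infinite.2 ‹_› (finite_of_finiteIndex K)
    exact GroupInvariant.normalized_of_nontrivial
  simp +contextual only [sigmaVolume, normalized_eq]

theorem extVolume_eq_sigmaVolume_normalized (hCi : C.IsoClosed) (hCf : C.FiniteIndexClosed)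
    (hσ : σ.IsoInvariantOn C) (hG : Finite G ∨ C.Virtually G) :
    extVolume C σ G = sigmaVolume σ.normalized G := by
  obtain hfin | hinf := finite_or_infinite G
  · rw [extVolume, if_pos hfin, sigmaVolume_normalized_of_finite]
  have hv := hG.resolve_left (not_finite_iff_infinite.2 hinf)
  obtain ⟨_, hK⟩ := hv.choose_spec
  have : Infinite hv.choose := not_finite_iff_infinite.1 fun _ =>
    not_finite_iff_infinite.2 hinf (finite_of_finiteIndex hv.choose)
  rw [extVolume, if_neg (not_finite_iff_infinite.2 hinf), dif_pos hv,
    sigmaVolume_normalized_of_infinite]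
  split_ifs with hCG
  · rfl
  · exact (sigmaVolume_eq_div hCi hCf hσ _ hK).symm

theorem finite_or_virtually_coprod (hCi : C.IsoClosed) (hCfree : C.FreeProductClosed)
    (hCfin : C.FiniteIndexClosed) (hCZ : C InfCyclic) (hA : Finite A ∨ C.Virtually A)
    (hB : Finite B ∨ C.Virtually B) : Finite (A ∗ B) ∨ C.Virtually (A ∗ B) :=
  GroupClass.virtually_withTrivial_iff.1 <|
    GroupClass.Virtually.coprod hCi.withTrivial hCfin.withTrivial
      (isCoprodAdditive_withTrivial hCi hCfree) (.inl hCZ)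
      (GroupClass.virtually_withTrivial_iff.2 hA) (GroupClass.virtually_withTrivial_iff.2 hB)

theorem GroupClass.OrFinite.finite_or_virtually (hC : C.IsoClosed) (hG : C.OrFinite G) :
    Finite G ∨ C.Virtually G :=
  hG.symm.imp_right fun h => ⟨⊤, inferInstance, hC G _ h ⟨Subgroup.topEquiv.symm⟩⟩

theorem exists_extVolume_eq_coe (hσ : σ.BoundedNetsOn C) (hG : C.OrFinite G) :
    ∃ v : ℝ, extVolume C σ G = v := by
  rw [extVolume]
  split_ifs with hfin hCG hv
  · exact ⟨_, rfl⟩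
  · obtain ⟨M, hM⟩ := hσ G hCG
    have upper : sigmaVolume σ G ≤ (M : ℝ) := sigmaVolume_le ⊤ fun K _ hK =>
      (div_index_le_iff K).1 (abs_le.1 (hM K hK)).2
    have lower : ((-M : ℝ) : EReal) ≤ sigmaVolume σ G := le_sigmaVolume fun H hH =>
      ⟨H, le_rfl, hH, (le_div_index_iff H).1 (abs_le.1 (hM H hH)).1⟩
    exact ⟨_, (EReal.coe_toReal (ne_top_of_le_ne_top (EReal.coe_ne_top _) upper)
      (ne_bot_of_le_ne_bot (EReal.coe_ne_bot _) lower)).symm⟩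
  all_goals exact (hG.elim hCG hfin).elim

end Normalization

theorem lemma3p7_general (C : GroupClass.{u}) (σ : GroupInvariant.{u})
    (hCiso : C.IsoClosed) (hCfree : C.FreeProductClosed) (hCfin : C.FiniteIndexClosed)
    (hCZ : C InfCyclic) (hσiso : σ.IsoInvariantOn C) (A B : Type u) [Group A] [Group B]
    (hA : Finite A ∨ C.Virtually A) (hB : Finite B ∨ C.Virtually B) :
    (Finite (A ∗ B) ∨ C.Virtually (A ∗ B)) ∧
    (0 ≤ σ InfCyclic →
      (∀ (A B : Type u) [Group A] [Group B], C A → C B → σ (A ∗ B) ≥ σ A + σ B + 1) →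
        extVolume C σ (A ∗ B) ≥ extVolume C σ A + extVolume C σ B + 1) ∧
    (σ InfCyclic ≤ 0 →
      (∀ (A B : Type u) [Group A] [Group B], C A → C B → σ (A ∗ B) ≤ σ A + σ B + 1) →
      (extVolume C σ A ≠ ⊥ ∨ extVolume C σ B ≠ ⊤) →
      (extVolume C σ A ≠ ⊤ ∨ extVolume C σ B ≠ ⊥) →
        extVolume C σ (A ∗ B) ≤ extVolume C σ A + extVolume C σ B + 1) := by
  have hAB := finite_or_virtually_coprod hCiso hCfree hCfin hCZ hA hB
  rw [extVolume_eq_sigmaVolume_normalized hCiso hCfin hσiso hA,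
    extVolume_eq_sigmaVolume_normalized hCiso hCfin hσiso hB,
    extVolume_eq_sigmaVolume_normalized hCiso hCfin hσiso hAB]
  rw [← GroupClass.virtually_withTrivial_iff] at hA hB
  rw [← GroupInvariant.normalized_of_nontrivial (σ := σ) (G := InfCyclic)]
  refine ⟨hAB, fun hσZ h => ?_, fun hσZ h h₁ h₂ => ?_⟩
  · refine le_sigmaVolume_coprod hCiso.withTrivial hCfin.withTrivial hσiso.normalized
      (isCoprodAdditive_normalized add_le_add hCiso hCfree hσiso fun A B _ _ hA hB => ?_)
      (.inl hCZ) hσZ hA hB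
    linarith [h A B hA hB]
  · refine sigmaVolume_coprod_le hCiso.withTrivial hCfin.withTrivial
      (isCoprodAdditive_normalized add_le_add hCiso hCfree hσiso fun A B _ _ hA hB => ?_)
      (.inl hCZ) hσZ hA hB h₁ h₂
    linarith [h A B hA hB]

theorem lemma3p7 (C : GroupClass.{u}) (σ : GroupInvariant.{u})
    (hCiso : C.IsoClosed) (hCfree : C.FreeProductClosed) (hCfin : C.FiniteIndexClosed)
    (hCZ : C InfCyclic)
    (hσiso : σ.IsoInvariantOn C) (hσbdd : σ.BoundedNetsOn C) (hσZ : σ InfCyclic = 0) :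
    -- the extended volume is defined on free products of groups in `C` and finite groups
    (∀ (A B : Type u) [Group A] [Group B], C.OrFinite A → C.OrFinite B →
      Finite (A ∗ B) ∨ C.Virtually (A ∗ B)) ∧
    -- (i)
    ((∀ (A B : Type u) [Group A] [Group B], C A → C B → σ (A ∗ B) ≥ σ A + σ B + 1) →
      ∀ (A B : Type u) [Group A] [Group B], C.OrFinite A → C.OrFinite B →
        extVolume C σ (A ∗ B) ≥ extVolume C σ A + extVolume C σ B + 1) ∧
    -- (ii)
    ((∀ (A B : Type u) [Group A] [Group B], C A → C B → σ (A ∗ B) ≤ σ A + σ B + 1) →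
      ∀ (A B : Type u) [Group A] [Group B], C.OrFinite A → C.OrFinite B →
        extVolume C σ (A ∗ B) ≤ extVolume C σ A + extVolume C σ B + 1) := by
  have general (A B : Type u) [Group A] [Group B] (hA : C.OrFinite A) (hB : C.OrFinite B) :=
    lemma3p7_general C σ hCiso hCfree hCfin hCZ hσiso A B (hA.finite_or_virtually hCiso)
      (hB.finite_or_virtually hCiso)
  refine ⟨fun A B _ _ hA hB => (general A B hA hB).1,
    fun h A B _ _ hA hB => (general A B hA hB).2.1 hσZ.ge h, fun h A B _ _ hA hB => ?_⟩
  obtain ⟨v, hv⟩ := exists_extVolume_eq_coe hσbdd hA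
  exact (general A B hA hB).2.2 hσZ.le h (.inl (hv ▸ EReal.coe_ne_bot v))
    (.inl (hv ▸ EReal.coe_ne_top v))
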